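/- Let $\gamma\colon[0,s]\to\mathbb R^2$ be a bounded curvature path from $(x,X)$ to $(y,Y)$ in $T\mathbb R^2$ with curvature bound $1$. That is, $\gamma$ is $C^1$ and piecewise $C^2$, it is parametrised by arc length ($\|\gamma'(t)\|=1$ for all $t\in[0,s]$), $\gamma(0)=x$, $\gamma'(0)=X$, $\gamma(s)=y$, $\gamma'(s)=Y$, and $\|\gamma''(t)\|\le 1$ for all $t\in[0,s]$ at which $\gamma''(t)$ is defined. Here piecewise $C^2$ means that $[0,s]$ is a finite union of consecutive closed intervals on each of which $\gamma$ is $C^2$, and derivatives at $0$ and $s$ are one-sided. Suppose that $\gamma$ intersects itself for the first time at $\gamma(t_1)=\gamma(t_2)$, where $0\le t_1<t_2\le s$; that is, $t_2\le v$ whenever $0\le u<v\le s$ and $\gamma(u)=\gamma(v)$. Then the loop $\gamma|_{[t_1,t_2]}$ has length at least $2\pi$. -/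

import Mathlib

open Set

/-- The Euclidean plane. -/
abbrev Plane : Type := EuclideanSpace ℝ (Fin 2)

/-- The velocity of a path `γ : [0, s] → ℝ²`; it is one-sided at the two endpoints of `[0, s]`,
and the values of `γ` outside `[0, s]` do not matter. -/
noncomputable def velocity (γ : ℝ → Plane) (s : ℝ) : ℝ → Plane :=
  derivWithin γ (Icc 0 s)

/-- `γ` is piecewise `C²` on `[0, s]`: there is a partition `0 = τ 0 < τ 1 < ⋯ < τ m = s` such
that the restriction of `γ` to each closed interval of the partition is `C²`. -/
def PiecewiseC2 (γ : ℝ → Plane) (s : ℝ) : Prop :=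
  ∃ (m : ℕ) (τ : ℕ → ℝ), τ 0 = 0 ∧ τ m = s ∧
    (∀ i < m, τ i < τ (i + 1)) ∧
    ∀ i < m, ContDiffOn ℝ 2 γ (Icc (τ i) (τ (i + 1)))

/-- `γ : [0, s] → ℝ²` is a bounded curvature path, with curvature bound `κ`, from `(x, X)` to
`(y, Y)` in the tangent bundle of the plane. -/
structure IsBoundedCurvaturePath (κ : ℝ) (x X y Y : Plane) (s : ℝ) (γ : ℝ → Plane) : Prop where
  nonneg : 0 ≤ s
  contDiffOn : ContDiffOn ℝ 1 γ (Icc 0 s)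
  piecewiseC2 : PiecewiseC2 γ s
  unit_speed : ∀ t ∈ Icc 0 s, ‖velocity γ s t‖ = 1
  source : γ 0 = x
  source_velocity : velocity γ s 0 = X
  target : γ s = y
  target_velocity : velocity γ s s = Y
  curvature_le : ∀ t ∈ Icc 0 s, DifferentiableWithinAt ℝ (velocity γ s) (Icc 0 s) t →
    ‖derivWithin (velocity γ s) (Icc 0 s) t‖ ≤ κ

/-- The path `γ : [0, s] → ℝ²` intersects itself at the times `t₁ < t₂`. -/
def IsSelfIntersection (γ : ℝ → Plane) (s t₁ t₂ : ℝ) : Prop :=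
  t₁ ∈ Icc 0 s ∧ t₂ ∈ Icc 0 s ∧ t₁ < t₂ ∧ γ t₁ = γ t₂

/-- The path `γ : [0, s] → ℝ²` intersects itself for the first time at `γ t₁ = γ t₂`, `t₁ < t₂`:
no point visited earlier is revisited before the time `t₂`. In this case the restriction of `γ` to
`[t₁, t₂]` is a loop. -/
def IsLoop (γ : ℝ → Plane) (s t₁ t₂ : ℝ) : Prop :=
  IsSelfIntersection γ s t₁ t₂ ∧ ∀ u v : ℝ, IsSelfIntersection γ s u v → t₂ ≤ v

/-- The length of the restriction of `γ` to `[a, b]`: the supremum of the lengths of inscribed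
polygonal lines. -/
noncomputable def pathLength (γ : ℝ → Plane) (a b : ℝ) : ENNReal :=
  eVariationOn γ (Icc a b)

/-! Curvature at most 1 makes the unit tangent `T` 1-Lipschitz, so it turns by an angle of at most
the elapsed time. On an interval of length `L ≤ 2π` with midpoint `m`, projecting the motion onto `T
m` gives speed at least `cos (t - m)`, hence a chord of length at least `2 sin (L / 2)`
(`two_mul_sin_half_le_norm_sub`). A loop has chord 0, which excludes `0 < L < 2π`. As length is
defined by inscribed polygons, the same chord bound on short pieces also shows that it is at least
the elapsed time (`ofReal_sub_le_eVariationOn`). -/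

open Filter Topology InnerProductGeometry

/-! ### Angles, chords and lengths for curves with 1-Lipschitz unit tangent. -/

section UnitVectors

variable {V : Type*} [NormedAddCommGroup V] [InnerProductSpace ℝ V]

/-- The angle between two unit vectors in terms of the length of the chord between them. -/
theorem angle_eq_two_mul_arcsin_of_norm_eq_one {x y : V} (hx : ‖x‖ = 1) (hy : ‖y‖ = 1) :
    angle x y = 2 * Real.arcsin (‖x - y‖ / 2) := by
  have h2 : ‖x - y‖ ≤ 2 := by
    have := norm_sub_le x y
    rw [hx, hy] at this
    linarith
  have h0 := norm_nonneg (x - y)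
  have hcos : Real.cos (2 * Real.arcsin (‖x - y‖ / 2)) = inner ℝ x y := by
    rw [Real.cos_two_mul, Real.cos_sq', Real.sin_arcsin (by linarith) (by linarith)]
    have := norm_sub_sq_real x y
    rw [hx, hy] at this
    nlinarith
  have hnn : 0 ≤ Real.arcsin (‖x - y‖ / 2) := Real.arcsin_nonneg.2 (by linarith)
  have hle := Real.arcsin_le_pi_div_two (‖x - y‖ / 2)
  rw [angle, hx, hy, ← hcos, mul_one, div_one, Real.arccos_cos (by linarith) (by linarith)]

/-- Limit of `n` equal contributions from pieces of length `d / n`: `f = arcsin` sums angles, `f =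
sin` sums chords. -/
theorem tendsto_mul_two_mul_div_of_hasDerivAt {f : ℝ → ℝ} (hf : HasDerivAt f 1 0) (h0 : f 0 = 0)
    (d : ℝ) : Tendsto (fun n : ℕ => (n : ℝ) * (2 * f (d / n / 2))) atTop (𝓝 d) := by
  have h1 : HasDerivAt (fun z : ℝ => 2 * f (d * z / 2)) d 0 := by
    have hlin : HasDerivAt (fun z : ℝ => d * z / 2) (d / 2) 0 := by
      simpa using ((hasDerivAt_id (0 : ℝ)).const_mul d).div_const 2
    have hf' : HasDerivAt f 1 (d * 0 / 2) := by simpa using hf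
    exact ((hf'.comp (0 : ℝ) hlin).const_mul 2).congr_deriv (by ring)
  have h2 := (hasDerivAt_iff_tendsto_slope_zero.1 h1).comp
    (tendsto_nhdsWithin_iff.2 ⟨tendsto_inv_atTop_nhds_zero_nat (𝕜 := ℝ), by
      filter_upwards [eventually_gt_atTop 0] with n hn
      simpa using hn.ne'⟩)
  refine h2.congr fun n => ?_
  simp [div_eq_mul_inv, h0]

/-- Along a curve of unit vectors with Lipschitz constant `1` the angle grows at most
with unit speed. -/
theorem angle_le_sub_of_norm_sub_le {T : ℝ → V} {a b : ℝ} (hab : a ≤ b)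
    (hT : ∀ t ∈ Icc a b, ‖T t‖ = 1)
    (hlip : ∀ u ∈ Icc a b, ∀ v ∈ Icc a b, u ≤ v → ‖T u - T v‖ ≤ v - u) :
    angle (T a) (T b) ≤ b - a := by
  have harcsin : HasDerivAt Real.arcsin 1 0 := by
    simpa using Real.hasDerivAt_arcsin (x := 0) (by norm_num) (by norm_num)
  -- Over `n` equal steps, each tangent chord is at most `h`, so each angle is at most `2 arcsin (h
  -- / 2)`. The triangle inequality for angles sums them, and `n → ∞` turns the bound into `b - a`.
  refine ge_of_tendsto
    (tendsto_mul_two_mul_div_of_hasDerivAt harcsin Real.arcsin_zero (b - a)) ?_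
  filter_upwards [eventually_gt_atTop 0] with n hn
  have hn' : (0 : ℝ) < n := by exact_mod_cast hn
  set h := (b - a) / n with hh
  have hh0 : 0 ≤ h := div_nonneg (by linarith) hn'.le
  have hnh : (n : ℝ) * h = b - a := by rw [hh]; field_simp
  have hmem : ∀ k ≤ n, a + k * h ∈ Icc a b := fun k hk => by
    have hk' : (k : ℝ) ≤ n := by exact_mod_cast hk
    have := mul_le_mul_of_nonneg_right hk' hh0
    have : 0 ≤ (k : ℝ) * h := by positivity
    constructor <;> linarith
  have key : ∀ k ≤ n, angle (T a) (T (a + k * h)) ≤ k * (2 * Real.arcsin (h / 2)) := by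
    intro k
    induction k with
    | zero =>
      intro _
      have : T a ≠ 0 := norm_pos_iff.1 (by rw [hT a ⟨le_rfl, hab⟩]; exact one_pos)
      simp [angle_self this]
    | succ k ih =>
      intro hk
      have hk0 := hmem k (by omega)
      have hk1 := hmem (k + 1) hk
      refine (angle_le_angle_add_angle _ (T (a + k * h)) _).trans ?_
      have h1 := ih (by omega)
      have h2 : angle (T (a + k * h)) (T (a + (k + 1 : ℕ) * h)) ≤ 2 * Real.arcsin (h / 2) := by
        rw [angle_eq_two_mul_arcsin_of_norm_eq_one (hT _ hk0) (hT _ hk1)]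
        have := hlip _ hk0 _ hk1 (by push_cast; linarith)
        have := Real.monotone_arcsin (show ‖T (a + k * h) - T (a + (k + 1 : ℕ) * h)‖ / 2 ≤ h / 2 by
          push_cast at this ⊢
          linarith)
        linarith
      push_cast at h1 h2 ⊢
      linarith
  simpa [hnh] using key n le_rfl

/-- Schur's comparison of a curve of curvature at most `1` with an arc of the unit circle of the
same length: the chord of the curve is at least as long as the chord of the arc. -/
theorem two_mul_sin_half_le_norm_sub {γ T : ℝ → V} {a b : ℝ} (hab : a ≤ b)
    (hb : b - a ≤ 2 * Real.pi) (hγ : ContinuousOn γ (Icc a b))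
    (hd : ∀ t ∈ Ioo a b, HasDerivAt γ (T t) t) (hT : ∀ t ∈ Icc a b, ‖T t‖ = 1)
    (hlip : ∀ u ∈ Icc a b, ∀ v ∈ Icc a b, u ≤ v → ‖T u - T v‖ ≤ v - u) :
    2 * Real.sin ((b - a) / 2) ≤ ‖γ b - γ a‖ := by
  -- From the midpoint every time is at distance at most `(b - a) / 2 ≤ π`, the range where cosine
  -- is decreasing.
  set m := (a + b) / 2 with hm
  have hmm : m ∈ Icc a b := ⟨by linarith, by linarith⟩
  have hinner : ∀ t ∈ Icc a b, Real.cos (t - m) ≤ inner ℝ (T m) (T t) := by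
    intro t ht
    have hcos : inner ℝ (T m) (T t) = Real.cos (angle (T m) (T t)) := by
      rw [cos_angle, hT m hmm, hT t ht]
      simp
    rw [hcos]
    have hangle : angle (T m) (T t) ≤ |t - m| := by
      rcases le_total m t with h | h
      · rw [abs_of_nonneg (by linarith)]
        have hs : Icc m t ⊆ Icc a b := Icc_subset_Icc hmm.1 ht.2
        exact angle_le_sub_of_norm_sub_le h (fun u hu => hT u (hs hu))
          fun u hu v hv => hlip u (hs hu) v (hs hv)
      · rw [abs_sub_comm, abs_of_nonneg (by linarith), angle_comm]
        have hs : Icc t m ⊆ Icc a b := Icc_subset_Icc ht.1 hmm.2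
        exact angle_le_sub_of_norm_sub_le h (fun u hu => hT u (hs hu))
          fun u hu v hv => hlip u (hs hu) v (hs hv)
    rw [← Real.cos_abs (t - m)]
    refine Real.cos_le_cos_of_nonneg_of_le_pi (angle_nonneg _ _) ?_ hangle
    rw [abs_le]
    constructor <;> linarith [ht.1, ht.2]
  -- Integrated form of the speed bound: `sin (t - m)` is the primitive of `cos (t - m)`.
  have hmono : MonotoneOn (fun t => inner ℝ (T m) (γ t) - Real.sin (t - m)) (Icc a b) := by
    have hder : ∀ t ∈ Ioo a b, HasDerivAt (fun t => inner ℝ (T m) (γ t) - Real.sin (t - m))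
        (inner ℝ (T m) (T t) - Real.cos (t - m)) t := by
      intro t ht
      have h1 := ((hasDerivAt_const t (T m)).inner ℝ (hd t ht))
      have h2 := ((hasDerivAt_id t).sub_const m).sin
      exact (h1.sub h2).congr_deriv (by simp)
    refine monotoneOn_of_deriv_nonneg (convex_Icc a b) ?_ ?_ ?_
    · exact (continuousOn_const.inner hγ).sub (by fun_prop)
    · rw [interior_Icc]
      exact fun t ht => (hder t ht).differentiableAt.differentiableWithinAt
    · rw [interior_Icc]
      intro t ht
      rw [(hder t ht).deriv]
      linarith [hinner t (Ioo_subset_Icc_self ht)]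
  have hle := hmono (left_mem_Icc.2 hab) (right_mem_Icc.2 hab) hab
  have hsa : Real.sin (a - m) = -Real.sin ((b - a) / 2) := by
    rw [← Real.sin_neg]
    congr 1
    rw [hm]
    ring
  have hsb : b - m = (b - a) / 2 := by rw [hm]; ring
  simp only [hsa, hsb] at hle
  have hCS := real_inner_le_norm (T m) (γ b - γ a)
  rw [hT m hmm, inner_sub_right] at hCS
  linarith

/-- The length of a unit speed curve of curvature at most `1` is at least the length of its
parameter interval. -/
theorem ofReal_sub_le_eVariationOn {γ T : ℝ → V} {a b : ℝ} (hab : a ≤ b)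
    (hγ : ContinuousOn γ (Icc a b)) (hd : ∀ t ∈ Ioo a b, HasDerivAt γ (T t) t)
    (hT : ∀ t ∈ Icc a b, ‖T t‖ = 1)
    (hlip : ∀ u ∈ Icc a b, ∀ v ∈ Icc a b, u ≤ v → ‖T u - T v‖ ≤ v - u) :
    ENNReal.ofReal (b - a) ≤ eVariationOn γ (Icc a b) := by
  have hsin : HasDerivAt Real.sin 1 0 := by simpa using Real.hasDerivAt_sin 0
  refine le_of_tendsto ((ENNReal.continuous_ofReal.tendsto _).comp
    (tendsto_mul_two_mul_div_of_hasDerivAt hsin Real.sin_zero (b - a))) ?_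
  -- The chord comparison applies only to pieces of length at most `2π`.
  have hsmall : ∀ᶠ n : ℕ in atTop, (b - a) / n < 2 * Real.pi :=
    (tendsto_const_div_atTop_nhds_zero_nat (b - a)).eventually
      (gt_mem_nhds (by positivity))
  filter_upwards [eventually_gt_atTop 0, hsmall] with n hn hlt
  have hn' : (0 : ℝ) < n := by exact_mod_cast hn
  simp only [Function.comp]
  set h := (b - a) / n with hh
  have hh0 : 0 ≤ h := div_nonneg (by linarith) hn'.le
  have hnh : (n : ℝ) * h = b - a := by rw [hh]; field_simp
  have hmem : ∀ k ≤ n, a + k * h ∈ Icc a b := fun k hk => by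
    have hk' : (k : ℝ) ≤ n := by exact_mod_cast hk
    have := mul_le_mul_of_nonneg_right hk' hh0
    have : 0 ≤ (k : ℝ) * h := by positivity
    constructor <;> linarith
  have hmono : Monotone fun k : ℕ => a + k * h := fun i j hij => by
    have : (i : ℝ) ≤ j := by exact_mod_cast hij
    have := mul_le_mul_of_nonneg_right this hh0
    dsimp only
    linarith
  refine le_trans ?_ (eVariationOn.sum_le_of_monotoneOn_Iic (f := γ) (n := n)
    (hmono.monotoneOn _) hmem)
  have hstep : ∀ k ∈ Finset.range n, ENNReal.ofReal (2 * Real.sin (h / 2)) ≤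
      edist (γ (a + (k + 1 : ℕ) * h)) (γ (a + k * h)) := by
    intro k hk
    rw [Finset.mem_range] at hk
    have hk0 := hmem k hk.le
    have hk1 := hmem (k + 1) hk
    have hs : Icc (a + k * h) (a + (k + 1 : ℕ) * h) ⊆ Icc a b := Icc_subset_Icc hk0.1 hk1.2
    have hlen : a + (k + 1 : ℕ) * h - (a + k * h) = h := by push_cast; ring
    rw [edist_dist, dist_eq_norm]
    refine ENNReal.ofReal_le_ofReal ?_
    have := two_mul_sin_half_le_norm_sub (γ := γ) (T := T) (hmono k.le_succ)
      (by simp only [Nat.succ_eq_add_one, hlen]; exact hlt.le) (hγ.mono hs)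
      (fun t ht => hd t (Ioo_subset_Ioo hk0.1 hk1.2 ht)) (fun t ht => hT t (hs ht))
      (fun u hu v hv => hlip u (hs hu) v (hs hv))
    simpa only [Nat.succ_eq_add_one, hlen] using this
  refine le_trans ?_ (Finset.sum_le_sum hstep)
  rw [Finset.sum_const, Finset.card_range, nsmul_eq_mul, ENNReal.ofReal_mul hn'.le,
    ENNReal.ofReal_natCast]

end UnitVectors

/-! ### Lipschitz bound for the velocity. -/

/-- A continuous function on `[a, b]` with derivative bounded by `C` in the interior is Lipschitz
with constant `C`. -/
theorem norm_sub_le_of_norm_deriv_le_Ioo {E : Type*} [NormedAddCommGroup E] [NormedSpace ℝ E]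
    {f f' : ℝ → E} {a b C : ℝ} (hf : ContinuousOn f (Icc a b))
    (hd : ∀ t ∈ Ioo a b, HasDerivAt f (f' t) t) (hC : ∀ t ∈ Ioo a b, ‖f' t‖ ≤ C)
    {u v : ℝ} (hu : u ∈ Icc a b) (hv : v ∈ Icc a b) (huv : u ≤ v) :
    ‖f v - f u‖ ≤ C * (v - u) := by
  rcases huv.eq_or_lt with rfl | hlt
  · simp
  have hab : a ≠ b := (hu.1.trans_lt (hlt.trans_le hv.2)).ne
  -- No derivative is given at the endpoints: the mean value inequality is used on the open square
  -- and extended to its closure by continuity.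
  have hopen : ∀ p ∈ Ioo a b ×ˢ Ioo a b, ‖f p.2 - f p.1‖ ≤ C * ‖p.2 - p.1‖ := fun p hp =>
    (convex_Ioo a b).norm_image_sub_le_of_norm_hasDerivWithin_le
      (fun t ht => (hd t ht).hasDerivWithinAt) hC hp.1 hp.2
  have hcl : closure (Ioo a b ×ˢ Ioo a b) = Icc a b ×ˢ Icc a b := by
    rw [closure_prod_eq, closure_Ioo hab]
  have hfst : ContinuousOn (fun p : ℝ × ℝ => f p.1) (Icc a b ×ˢ Icc a b) :=
    hf.comp continuousOn_fst fun p hp => hp.1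
  have hsnd : ContinuousOn (fun p : ℝ × ℝ => f p.2) (Icc a b ×ˢ Icc a b) :=
    hf.comp continuousOn_snd fun p hp => hp.2
  have h := le_on_closure hopen (hcl ▸ (hsnd.sub hfst).norm)
    (Continuous.continuousOn (by fun_prop)) (x := (u, v)) (hcl ▸ ⟨hu, hv⟩)
  simpa [Real.norm_eq_abs, abs_of_pos (sub_pos.2 hlt)] using h

namespace IsBoundedCurvaturePath

variable {κ s : ℝ} {x X y Y : Plane} {γ : ℝ → Plane}

theorem hasDerivAt (hγ : IsBoundedCurvaturePath κ x X y Y s γ) {t : ℝ} (ht : t ∈ Ioo 0 s) :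
    HasDerivAt γ (velocity γ s t) t := by
  have hd := hγ.contDiffOn.differentiableOn (by norm_num) t (Ioo_subset_Icc_self ht)
  exact hd.hasDerivWithinAt.hasDerivAt (Icc_mem_nhds ht.1 ht.2)

theorem continuousOn_velocity (hγ : IsBoundedCurvaturePath κ x X y Y s γ) (hs : 0 < s) :
    ContinuousOn (velocity γ s) (Icc 0 s) :=
  hγ.contDiffOn.continuousOn_derivWithin (uniqueDiffOn_Icc hs) (by norm_num)

/-- The velocity is differentiable, with derivative bounded by `κ`, inside each interval on which
the path is `C²`. -/
theorem norm_velocity_sub_le_of_contDiffOn (hγ : IsBoundedCurvaturePath κ x X y Y s γ)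
    (hs : 0 < s) {a b : ℝ} (ha : 0 ≤ a) (hb : b ≤ s) (h2 : ContDiffOn ℝ 2 γ (Icc a b))
    {u v : ℝ} (hu : u ∈ Icc a b) (hv : v ∈ Icc a b) (huv : u ≤ v) :
    ‖velocity γ s v - velocity γ s u‖ ≤ κ * (v - u) := by
  have hdiff : ∀ t ∈ Ioo a b, DifferentiableAt ℝ (velocity γ s) t := by
    intro t ht
    have h1 : ContDiffOn ℝ 1 (deriv γ) (Ioo a b) :=
      (h2.mono Ioo_subset_Icc_self).deriv_of_isOpen isOpen_Ioo (by norm_num)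
    have h3 := (h1.differentiableOn (by norm_num) t ht).differentiableAt (Ioo_mem_nhds ht.1 ht.2)
    -- Near an interior point of the piece, `velocity` is the ordinary derivative of `γ`.
    refine h3.congr_of_eventuallyEq ?_
    filter_upwards [Ioo_mem_nhds ht.1 ht.2] with r hr
    exact derivWithin_of_mem_nhds (Icc_mem_nhds (ha.trans_lt hr.1) (hr.2.trans_le hb))
  refine norm_sub_le_of_norm_deriv_le_Ioo
    ((hγ.continuousOn_velocity hs).mono (Icc_subset_Icc ha hb))
    (fun t ht => (hdiff t ht).hasDerivAt) (fun t ht => ?_) hu hv huv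
  have hmem : t ∈ Ioo 0 s := ⟨ha.trans_lt ht.1, ht.2.trans_le hb⟩
  rw [← derivWithin_of_mem_nhds (Icc_mem_nhds hmem.1 hmem.2)]
  exact hγ.curvature_le t (Ioo_subset_Icc_self hmem) (hdiff t ht).differentiableWithinAt

/-- The velocity of a path of curvature at most `κ` is Lipschitz with constant `κ`. -/
theorem norm_velocity_sub_le (hγ : IsBoundedCurvaturePath κ x X y Y s γ) (hs : 0 < s)
    {u v : ℝ} (hu : u ∈ Icc 0 s) (hv : v ∈ Icc 0 s) (huv : u ≤ v) :
    ‖velocity γ s v - velocity γ s u‖ ≤ κ * (v - u) := by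
  obtain ⟨m, τ, h0, hm, hlt, h2⟩ := hγ.piecewiseC2
  have hτ : ∀ i j, i ≤ j → j ≤ m → τ i ≤ τ j := by
    intro i j hij
    induction j, hij using Nat.le_induction with
    | base => exact fun _ => le_rfl
    | succ j _ ih => exact fun hj => (ih (by omega)).trans (hlt j hj).le
  -- The velocity need not be differentiable at a breakpoint, so the bounds on the pieces are joined
  -- there by the triangle inequality.
  have key : ∀ k ≤ m, ∀ u v : ℝ, 0 ≤ u → u ≤ v → v ≤ τ k →
      ‖velocity γ s v - velocity γ s u‖ ≤ κ * (v - u) := by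
    intro k
    induction k with
    | zero =>
      intro _ u v hu huv hv
      obtain rfl : u = v := by linarith
      simp
    | succ k ih =>
      intro hk u v hu huv hv
      have hk0 : 0 ≤ τ k := h0 ▸ hτ 0 k (Nat.zero_le k) (by omega)
      have hks : τ (k + 1) ≤ s := hm ▸ hτ (k + 1) m hk le_rfl
      have hkk := hlt k hk
      have piece := fun {p q : ℝ} => hγ.norm_velocity_sub_le_of_contDiffOn (u := p) (v := q)
        hs hk0 hks (h2 k hk)
      rcases le_total v (τ k) with hvk | hvk
      · exact ih (by omega) u v hu huv hvk
      rcases le_total (τ k) u with huk | huk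
      · exact piece ⟨huk, huv.trans hv⟩ ⟨hvk, hv⟩ huv
      · have e1 := ih (by omega) u (τ k) hu huk le_rfl
        have e2 := piece ⟨le_rfl, hkk.le⟩ ⟨hvk, hv⟩ hvk
        have e3 := norm_sub_le_norm_sub_add_norm_sub (velocity γ s v) (velocity γ s (τ k))
          (velocity γ s u)
        linarith
  exact key m le_rfl u v hu.1 huv (hm ▸ hv.2)

end IsBoundedCurvaturePath

theorem corollary4p8 (x X y Y : Plane) (s : ℝ) (γ : ℝ → Plane)
    (hγ : IsBoundedCurvaturePath 1 x X y Y s γ) (t₁ t₂ : ℝ) (hloop : IsLoop γ s t₁ t₂) :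
    ENNReal.ofReal (2 * Real.pi) ≤ pathLength γ t₁ t₂ := by
  obtain ⟨⟨ht₁, ht₂, hlt, heq⟩, -⟩ := hloop
  have hs : 0 < s := ht₁.1.trans_lt (hlt.trans_le ht₂.2)
  have hsub : Icc t₁ t₂ ⊆ Icc 0 s := Icc_subset_Icc ht₁.1 ht₂.2
  have hcont : ContinuousOn γ (Icc t₁ t₂) := hγ.contDiffOn.continuousOn.mono hsub
  have hd : ∀ t ∈ Ioo t₁ t₂, HasDerivAt γ (velocity γ s t) t := fun t ht =>
    hγ.hasDerivAt (Ioo_subset_Ioo ht₁.1 ht₂.2 ht)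
  have hT : ∀ t ∈ Icc t₁ t₂, ‖velocity γ s t‖ = 1 := fun t ht => hγ.unit_speed t (hsub ht)
  have hlip : ∀ u ∈ Icc t₁ t₂, ∀ v ∈ Icc t₁ t₂, u ≤ v →
      ‖velocity γ s u - velocity γ s v‖ ≤ v - u := fun u hu v hv huv => by
    rw [norm_sub_rev]
    simpa using hγ.norm_velocity_sub_le hs (hsub hu) (hsub hv) huv
  refine le_trans (ENNReal.ofReal_le_ofReal ?_)
    (ofReal_sub_le_eVariationOn hlt.le hcont hd hT hlip)
  -- If `0 < t₂ - t₁ < 2π`, the chord bound `2 sin ((t₂ - t₁) / 2)` is positive, but the chord of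
  -- the loop is zero.
  by_contra! hshort
  have hchord := two_mul_sin_half_le_norm_sub hlt.le hshort.le hcont hd hT hlip
  have hpos : 0 < Real.sin ((t₂ - t₁) / 2) :=
    Real.sin_pos_of_pos_of_lt_pi (by linarith) (by linarith)
  rw [heq, sub_self, norm_zero] at hchord
  linarith
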